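/- Let $n\ge 2$ be an integer, $0<b<1$, $a=2(n-1)$ and $\kappa_0=a^{-(b+1)/2}$. Let $$\mathcal F_\sigma[v]=vv_{\sigma\sigma}-\tfrac12 v_\sigma^2+\frac{n-1-v}{\sigma}v_\sigma+\frac{2(n-1)}{\sigma^2}v(1-v)$$ be the Ricci flow operator acting on slope functions $v=\psi_s^2$ of rotationally symmetric metrics, written as a function of the radius. Let $\mathfrak B:[0,\infty)\to(0,\infty)$ be the profile of the Bryant soliton, that is, a smooth positive solution of $\mathcal F_\sigma[\mathfrak B]=0$ on $(0,\infty)$ with $\mathfrak B(0)=1$, normalised by $\sigma^2\mathfrak B(\sigma)\to1$ as $\sigma\to\infty$. Let $\mathfrak C:[0,\infty)\to[0,\infty)$ be a smooth bounded solution of the linearised equation $d\mathcal F_{\mathfrak B}[\mathfrak C]=-\sigma\mathfrak B_\sigma$ on $(0,\infty)$ with $\mathfrak C(0)=0$ and $\mathfrak C>0$ on $(0,\infty)$. For $t>0$ put $\tau=\log t$, $\theta=t^{(b+1)/2}$, $\theta_t=d\theta/dt$, and relate the coordinates by $r=\sigma\theta=\rho\sqrt t$, so that $\rho=\sigma t^{b/2}$.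 Define the parabolic barriers $$v_{\rm para}^\pm=(1\pm\gamma_\pm)\,\rho^{-2}(\rho^2+a)^{1+b}e^{b\tau}\pm\frac{D}{\rho^4}e^{2b\tau}$$ and the inner barriers $$v_{\rm in}^\pm=\mathfrak B(\kappa_\pm\sigma)+(1\mp\epsilon)\,\kappa_\pm^{-2}\,\mathfrak C(\kappa_\pm\sigma)\,\theta\theta_t .$$ **Theorem.** Let $\rho_*>0$, $\tau_*\in\mathbb R$, $0<\gamma_+<3$ and $0<\gamma_-<\tfrac34$. For every sufficiently large $D$ (that is, $D\ge D_0$ for some $D_0>0$) and every sufficiently large $\sigma_*$ (that is, $\sigma_*\ge\sigma_0$ for some $\sigma_0>0$ that may depend on $D$) there are $\kappa_+,\kappa_-\in[\kappa_0/2,2\kappa_0]$, independent of $\epsilon$, such that for every $\epsilon>0$ there is $t_*\in(0,e^{\tau_*}]$ with the following property. For all $0<t<t_*$, the point $\sigma=3\sigma_*$ lies in $\{\rho<\rho_*\}$, and the gluing conditions hold: $$v_{\rm in}^-(\sigma_*,t)>v_{\rm para}^-(\sigma_*,t),\qquad v_{\rm para}^-(3\sigma_*,t)>v_{\rm in}^-(3\sigma_*,t),$$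 $$v_{\rm in}^+(\sigma_*,t)<v_{\rm para}^+(\sigma_*,t),\qquad v_{\rm para}^+(3\sigma_*,t)<v_{\rm in}^+(3\sigma_*,t).$$ -/

import Mathlib

open scoped ContDiff Topology

noncomputable section

namespace RicciNeckpinch

/-- The constant `a = 2 (n - 1)`, where the manifold is `S^{n+1}`. -/
def aConst (n : ℕ) : ℝ := 2 * ((n : ℝ) - 1)

/-- The constant `κ₀ = a ^ (-(b+1)/2)`. -/
def kappaZero (n : ℕ) (b : ℝ) : ℝ := aConst n ^ (-(b + 1) / 2)

/-! ### The Ricci flow operator in the radial coordinate -/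

/-- The right-hand side of Ricci flow `v_t = F_r[v]` for the slope function `v = ψ_s²`. -/
def opF (n : ℕ) (v : ℝ → ℝ) (r : ℝ) : ℝ :=
  v r * deriv (deriv v) r - 1 / 2 * deriv v r ^ 2 + ((n : ℝ) - 1 - v r) / r * deriv v r
    + 2 * ((n : ℝ) - 1) / r ^ 2 * (v r * (1 - v r))

/-- The linear part of `opF`. -/
def opL (n : ℕ) (v : ℝ → ℝ) (r : ℝ) : ℝ :=
  (aConst n / 2 * (r * deriv v r) + aConst n * v r) / r ^ 2

/-- The symmetric bilinear form whose diagonal is the quadratic part of `opF`. -/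
def opQ (n : ℕ) (v w : ℝ → ℝ) (r : ℝ) : ℝ :=
  (1 / 2 * (v r * (r ^ 2 * deriv (deriv w) r) + w r * (r ^ 2 * deriv (deriv v) r))
    - 1 / 2 * ((r * deriv v r) * (r * deriv w r))
    - 1 / 2 * (v r * (r * deriv w r) + w r * (r * deriv v r))
    - aConst n * (v r * w r)) / r ^ 2

theorem opF_eq (n : ℕ) (v : ℝ → ℝ) {r : ℝ} (hr : r ≠ 0) :
    opF n v r = opL n v r + opQ n v v r := by
  unfold opF opL opQ aConst
  field_simp
  ring

/-- The differential of `opF` at `v` in the direction `w`. -/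
def opDF (n : ℕ) (v w : ℝ → ℝ) (r : ℝ) : ℝ := opL n w r + 2 * opQ n v w r

/-! ### The Bryant soliton and the first correction to it -/

/-- `B` is the slope function (squared derivative of the radius by arclength, as a function of the
radius `σ ∈ [0, ∞)`) of the Bryant soliton: a positive stationary solution of the flow that is
smooth up to the pole `σ = 0`, scaled so that `B σ = σ⁻² + o(σ⁻²)` as `σ → ∞`. -/
structure IsBryantProfile (n : ℕ) (B : ℝ → ℝ) : Prop where
  smooth : ContDiffOn ℝ ∞ B (Set.Ici 0)
  pos : ∀ σ, 0 ≤ σ → 0 < B σ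
  at_pole : B 0 = 1
  stationary : ∀ σ, 0 < σ → opF n B σ = 0
  scale : Filter.Tendsto (fun σ => σ ^ 2 * B σ) Filter.atTop (𝓝 1)

/-- `C` is a strictly positive bounded solution on `[0, ∞)` of the linearised equation
`dF_B[C] = -σ B'(σ)`. Such solutions differ from each other by multiples of `σ B'(σ)`;
no particular one is singled out. -/
structure IsInnerCorrection (n : ℕ) (B C : ℝ → ℝ) : Prop where
  smooth : ContDiffOn ℝ ∞ C (Set.Ici 0)
  at_pole : C 0 = 0
  pos : ∀ σ, 0 < σ → 0 < C σ
  bounded : ∃ M : ℝ, ∀ σ, 0 ≤ σ → C σ ≤ M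
  linearised : ∀ σ, 0 < σ → opDF n B C σ = -(σ * deriv B σ)

/-! ### Coordinates: `σ = r / θ`, `θ = t ^ ((b+1)/2)`, `ρ = r / √t`, `τ = log t` -/

/-- The rescaled time `θ = t ^ ((b+1)/2)`. -/
def theta (b t : ℝ) : ℝ := t ^ ((b + 1) / 2)

/-- The product `θ θ_t`. -/
def thetaThetaT (b t : ℝ) : ℝ := theta b t * deriv (theta b) t

/-- The value of `ρ` at the point whose inner coordinate is `σ`, at time `t`. -/
def rhoOf (b σ t : ℝ) : ℝ := σ * theta b t / √t

/-! ### The barriers -/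

/-- The profile `ρ⁻² (ρ² + a)^(1+b)` of the approximate solution in the parabolic region. -/
def paraProfile (n : ℕ) (b ρ : ℝ) : ℝ := (ρ ^ 2 + aConst n) ^ (1 + b) / ρ ^ 2

/-- The upper parabolic barrier in parabolic coordinates. -/
def vParaPlus (n : ℕ) (b γ D ρ τ : ℝ) : ℝ :=
  (1 + γ) * paraProfile n b ρ * Real.exp (b * τ) + D / ρ ^ 4 * Real.exp (2 * b * τ)

/-- The lower parabolic barrier in parabolic coordinates. -/
def vParaMinus (n : ℕ) (b γ D ρ τ : ℝ) : ℝ :=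
  (1 - γ) * paraProfile n b ρ * Real.exp (b * τ) - D / ρ ^ 4 * Real.exp (2 * b * τ)

/-- The upper inner barrier in the coordinates `(σ, t)`. -/
def vInPlus (B C : ℝ → ℝ) (b ε κ σ t : ℝ) : ℝ :=
  B (κ * σ) + (1 - ε) * (C (κ * σ) / κ ^ 2) * thetaThetaT b t

/-- The lower inner barrier in the coordinates `(σ, t)`. -/
def vInMinus (B C : ℝ → ℝ) (b ε κ σ t : ℝ) : ℝ :=
  B (κ * σ) + (1 + ε) * (C (κ * σ) / κ ^ 2) * thetaThetaT b t

end RicciNeckpinch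

end

namespace RicciNeckpinch

open Filter Set

/-! ### Asymptotics of the Bryant profile at infinity. -/

namespace IsBryantProfile

variable {n : ℕ} {B : ℝ → ℝ}

/-! All four inequalities are strict and hold at fixed `σ`, so it suffices to compare limits as `t →
0`. The `C` term dies with `θθ_t ~ t^b`, so with `α = a^(1+b)` one compares `B (κσ)` to `(1±γ)α/σ² ±
D/σ⁴`. Since `B x = x⁻² + O(x⁻⁴)`, choosing `κ⁻² = (1±γ)α ± D/(2σs²)` makes the leading `α` terms
cancel. In units of `±D/σs⁴` the inner barrier then has `1/2` against `1` at `σs`, but `1/18`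
against `1/81` at `3σs`: the order reverses, and large `D` absorbs the error. The expansion needs
proof, as only `f = x²B → 1` is given. For `G = x³f'` the soliton equation reads `f G' = x(-(n-1)G +
bounded terms)` while `G/x²` is bounded, so a large level `|G| = K` cannot be crossed outwards.
Integrating `|f'| ≤ K/x³` from infinity gives `f = 1 + O(x⁻²)`. -/

theorem contDiffAt (hB : IsBryantProfile n B) {x : ℝ} (hx : 0 < x) : ContDiffAt ℝ ∞ B x :=
  hB.smooth.contDiffAt (Ici_mem_nhds hx)

theorem hasDerivAt (hB : IsBryantProfile n B) {x : ℝ} (hx : 0 < x) :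
    HasDerivAt B (deriv B x) x :=
  ((hB.contDiffAt hx).differentiableAt (by simp)).hasDerivAt

theorem hasDerivAt_deriv (hB : IsBryantProfile n B) {x : ℝ} (hx : 0 < x) :
    HasDerivAt (deriv B) (deriv (deriv B) x) x := by
  have h : ContDiffOn ℝ ∞ (deriv B) (Ioi 0) :=
    (hB.smooth.mono Ioi_subset_Ici_self).deriv_of_isOpen isOpen_Ioi (by simp)
  exact ((h.contDiffAt (Ioi_mem_nhds hx)).differentiableAt (by simp)).hasDerivAt

/-- The derivative of the scaled profile `x ^ 2 * B x`. -/
theorem hasDerivAt_scaled (hB : IsBryantProfile n B) {x : ℝ} (hx : 0 < x) :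
    HasDerivAt (fun y => y ^ 2 * B y) (2 * x * B x + x ^ 2 * deriv B x) x := by
  refine ((hasDerivAt_pow 2 x).mul (hB.hasDerivAt hx)).congr_deriv ?_
  push_cast
  ring

/-- The weighted derivative `x ^ 3 * (x ^ 2 * B x)'` of the scaled profile. -/
noncomputable def scaledSlope (B : ℝ → ℝ) (x : ℝ) : ℝ := x ^ 3 * (2 * x * B x + x ^ 2 * deriv B x)

theorem hasDerivAt_scaledSlope (hB : IsBryantProfile n B) {x : ℝ} (hx : 0 < x) :
    HasDerivAt (scaledSlope B)
      (8 * x ^ 3 * B x + 7 * x ^ 4 * deriv B x + x ^ 5 * deriv (deriv B) x) x := by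
  have h := (hasDerivAt_pow 3 x).mul
    ((((hasDerivAt_id x).const_mul 2).mul (hB.hasDerivAt hx)).add
      ((hasDerivAt_pow 2 x).mul (hB.hasDerivAt_deriv hx)))
  refine h.congr_deriv ?_
  simp
  ring

/-- The stationary equation, rewritten for the scaled slope. -/
theorem mul_deriv_scaledSlope (hB : IsBryantProfile n B) {x : ℝ} (hx : 0 < x) :
    x ^ 2 * B x * (8 * x ^ 3 * B x + 7 * x ^ 4 * deriv B x + x ^ 5 * deriv (deriv B) x) =
      x * (6 * (x ^ 2 * B x) * (scaledSlope B x / x ^ 2) + (scaledSlope B x / x ^ 2) ^ 2 / 2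
        - ((n : ℝ) - 1) * scaledSlope B x + (2 * ((n : ℝ) - 1) - 6) * (x ^ 2 * B x) ^ 2) := by
  have h := hB.stationary x hx
  unfold opF at h
  unfold scaledSlope
  field_simp at h ⊢
  linear_combination h

/-- Arbitrarily far out, the logarithmic slope of the scaled profile is small. -/
theorem exists_abs_slope_lt (hB : IsBryantProfile n B) (X : ℝ) :
    ∃ x, X ≤ x ∧ 0 < x ∧ |x * (2 * x * B x + x ^ 2 * deriv B x)| < 1 := by
  have hev : ∀ᶠ x in atTop, |x ^ 2 * B x - 1| < 1 / 8 := by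
    have := (Metric.tendsto_nhds.1 hB.scale) (1 / 8) (by norm_num)
    simpa [Real.dist_eq] using this
  obtain ⟨Y, hY⟩ := eventually_atTop.1 hev
  set y := max (max X Y) 1 with hy
  have hy1 : 1 ≤ y := le_max_right _ _
  have hyX : X ≤ y := (le_max_left X Y).trans (le_max_left _ _)
  have hyY : Y ≤ y := (le_max_right X Y).trans (le_max_left _ _)
  -- Mean value theorem on `[y, 2y]`: convergence of `x²B` makes its increment there less than
  -- `1/4`, and `x < 2y`.
  obtain ⟨x, hx, hxs⟩ := exists_hasDerivAt_eq_slope (fun y => y ^ 2 * B y)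
    (fun x => 2 * x * B x + x ^ 2 * deriv B x) (show y < 2 * y by linarith)
    (fun z hz => (hB.hasDerivAt_scaled (by linarith [hz.1])).continuousAt.continuousWithinAt)
    (fun z hz => hB.hasDerivAt_scaled (by linarith [hz.1]))
  refine ⟨x, by linarith [hx.1], by linarith [hx.1], ?_⟩
  have h1 := abs_lt.1 (hY y hyY)
  have h2 := abs_lt.1 (hY (2 * y) (by linarith))
  have hslope : y * (2 * x * B x + x ^ 2 * deriv B x) = (2 * y) ^ 2 * B (2 * y) - y ^ 2 * B y := by
    rw [hxs]
    field_simp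
    ring
  have hy0 : 0 < y := by linarith
  have hb : |y * (2 * x * B x + x ^ 2 * deriv B x)| < 1 / 4 := by
    rw [hslope, abs_lt]
    constructor <;> linarith [h1.1, h1.2, h2.1, h2.2]
  rw [abs_mul, abs_of_pos hy0] at hb
  rw [abs_mul, abs_of_pos (by linarith [hx.1] : 0 < x)]
  have := mul_le_mul_of_nonneg_right hx.2.le (abs_nonneg (2 * x * B x + x ^ 2 * deriv B x))
  linarith

/-- The scaled slope of the Bryant profile is bounded near infinity. -/
theorem exists_abs_scaledSlope_le (hn : 2 ≤ n) (hB : IsBryantProfile n B) :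
    ∃ K x₀ : ℝ, 0 < K ∧ 0 < x₀ ∧ ∀ x, x₀ ≤ x → |scaledSlope B x| ≤ K := by
  have hm : (1 : ℝ) ≤ (n : ℝ) - 1 := by
    have : (2 : ℝ) ≤ n := by exact_mod_cast hn
    linarith
  set m : ℝ := (n : ℝ) - 1 with hmdef
  have hev : ∀ᶠ x in atTop, |x ^ 2 * B x - 1| < 1 := by
    have := (Metric.tendsto_nhds.1 hB.scale) 1 (by norm_num)
    simpa [Real.dist_eq] using this
  obtain ⟨Y, hY⟩ := eventually_atTop.1 hev
  set c : ℝ := |2 * m - 6| with hc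
  have hc0 : 0 ≤ c := abs_nonneg _
  obtain ⟨x₀, hXx, hx0, hs⟩ := hB.exists_abs_slope_lt (max Y (14 + 4 * c))
  have hYx : Y ≤ x₀ := (le_max_left _ _).trans hXx
  have hcx : 14 + 4 * c ≤ x₀ := (le_max_right _ _).trans hXx
  have hK : 14 + 4 * c ≤ x₀ ^ 2 := by nlinarith
  have hK0 : 0 < x₀ ^ 2 := by positivity
  -- At `|G| = x₀²` the terms competing with `m x₀²` total at most `12 + 1/2 + 4c`, using `f < 2`.
  have hmK : 14 + 4 * c ≤ m * x₀ ^ 2 := by nlinarith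
  have hinit : |scaledSlope B x₀| < x₀ ^ 2 := by
    have : scaledSlope B x₀ = x₀ ^ 2 * (x₀ * (2 * x₀ * B x₀ + x₀ ^ 2 * deriv B x₀)) := by
      unfold scaledSlope; ring
    rw [this, abs_mul, abs_of_pos hK0]
    nlinarith
  -- Here `q = x₀²/x²`, so on the barrier `G = ±x₀²` the quotient `G/x²` is `±q`, with `q ≤ 1`.
  have key : ∀ x, x₀ ≤ x → ∃ f q : ℝ, 0 < f ∧ f < 2 ∧ 0 ≤ q ∧ q ≤ 1 ∧ |(2 * m - 6) * f ^ 2| ≤ 4 * c ∧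
      f * (8 * x ^ 3 * B x + 7 * x ^ 4 * deriv B x + x ^ 5 * deriv (deriv B) x) =
      x * (6 * f * (scaledSlope B x / x₀ ^ 2 * q) + (scaledSlope B x / x₀ ^ 2 * q) ^ 2 / 2
        - m * scaledSlope B x + (2 * m - 6) * f ^ 2) := by
    intro x hx
    have hxp : 0 < x := hx0.trans_le hx
    have hf := abs_lt.1 (hY x (hYx.trans hx))
    have hf0 : 0 < x ^ 2 * B x := mul_pos (by positivity) (hB.pos x hxp.le)
    refine ⟨x ^ 2 * B x, x₀ ^ 2 / x ^ 2, hf0, by linarith, by positivity, ?_, ?_, ?_⟩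
    · rw [div_le_one (by positivity)]
      exact pow_le_pow_left₀ hx0.le hx 2
    · rw [abs_mul, ← hc, mul_comm, abs_of_nonneg (sq_nonneg _)]
      exact mul_le_mul_of_nonneg_right (by nlinarith) hc0
    · rw [hB.mul_deriv_scaledSlope hxp, div_mul_div_cancel₀ hK0.ne']
  refine ⟨x₀ ^ 2, x₀, hK0, hx0, fun x hx => abs_le.2 ⟨?_, ?_⟩⟩
  · have h := image_le_of_deriv_right_lt_deriv_boundary' (a := x₀) (b := x)
      (f := fun _ => -x₀ ^ 2) (f' := fun _ => 0) (B := scaledSlope B)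
      (B' := fun x => 8 * x ^ 3 * B x + 7 * x ^ 4 * deriv B x + x ^ 5 * deriv (deriv B) x)
      continuousOn_const (fun _ _ => hasDerivWithinAt_const _ _ _) (abs_lt.1 hinit).1.le
      (fun z hz => (hB.hasDerivAt_scaledSlope (hx0.trans_le hz.1)).continuousAt.continuousWithinAt)
      (fun z hz => (hB.hasDerivAt_scaledSlope (hx0.trans_le hz.1)).hasDerivWithinAt) ?_
    · exact h (right_mem_Icc.2 hx)
    · intro z hz hEq
      obtain ⟨f, q, hf0, hf2, hq0, hq1, hcf, heq⟩ := key z hz.1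
      rw [← hEq, neg_div, div_self hK0.ne'] at heq
      have h1 := (abs_le.1 hcf).1
      have : 0 < z * (6 * f * (-1 * q) + (-1 * q) ^ 2 / 2 - m * -x₀ ^ 2 + (2 * m - 6) * f ^ 2) :=
        mul_pos (hx0.trans_le hz.1) (by nlinarith [mul_le_mul hf2.le hq1 hq0 (by norm_num)])
      rw [← heq] at this
      exact pos_of_mul_pos_right this hf0.le
  · have h := image_le_of_deriv_right_lt_deriv_boundary' (a := x₀) (b := x)
      (B := fun _ => x₀ ^ 2) (B' := fun _ => 0) (f := scaledSlope B)
      (f' := fun x => 8 * x ^ 3 * B x + 7 * x ^ 4 * deriv B x + x ^ 5 * deriv (deriv B) x)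
      (fun z hz => (hB.hasDerivAt_scaledSlope (hx0.trans_le hz.1)).continuousAt.continuousWithinAt)
      (fun z hz => (hB.hasDerivAt_scaledSlope (hx0.trans_le hz.1)).hasDerivWithinAt)
      (abs_lt.1 hinit).2.le continuousOn_const (fun _ _ => hasDerivWithinAt_const _ _ _) ?_
    · exact h (right_mem_Icc.2 hx)
    · intro z hz hEq
      obtain ⟨f, q, hf0, hf2, hq0, hq1, hcf, heq⟩ := key z hz.1
      rw [hEq, div_self hK0.ne'] at heq
      have h1 := (abs_le.1 hcf).2
      have : z * (6 * f * (1 * q) + (1 * q) ^ 2 / 2 - m * x₀ ^ 2 + (2 * m - 6) * f ^ 2) < 0 :=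
        mul_neg_of_pos_of_neg (hx0.trans_le hz.1)
          (by nlinarith [mul_le_mul hf2.le hq1 hq0 (by norm_num)])
      rw [← heq] at this
      exact (pos_iff_neg_of_mul_neg this).1 hf0

/-- The asymptotic expansion `B x = x⁻² + O(x⁻⁴)` of the Bryant profile. -/
theorem exists_abs_scaled_sub_one_le (hn : 2 ≤ n) (hB : IsBryantProfile n B) :
    ∃ K x₀ : ℝ, 0 < K ∧ 0 < x₀ ∧ ∀ x, x₀ ≤ x → |x ^ 2 * B x - 1| ≤ K / x ^ 2 := by
  obtain ⟨K, x₀, hK, hx0, hG⟩ := hB.exists_abs_scaledSlope_le hn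
  have hd : ∀ x, 0 < x → ∀ s : ℝ, HasDerivAt (fun y => y ^ 2 * B y + s * (K / y ^ 2))
      ((scaledSlope B x - s * (2 * K)) / x ^ 3) x := by
    intro x hx s
    have h := (hB.hasDerivAt_scaled hx).add
      ((((hasDerivAt_pow 2 x).inv (by positivity)).const_mul K).const_mul s)
    refine (h.congr_deriv ?_)
    unfold scaledSlope
    field_simp
    push_cast
    ring
  have hlim : ∀ s : ℝ, Tendsto (fun y => y ^ 2 * B y + s * (K / y ^ 2)) atTop (𝓝 1) := by
    intro s
    have h0 : Tendsto (fun y : ℝ => K / y ^ 2) atTop (𝓝 0) :=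
      tendsto_const_nhds.div_atTop (tendsto_pow_atTop two_ne_zero)
    simpa using hB.scale.add (h0.const_mul s)
  have hcont : ∀ s : ℝ, ContinuousOn (fun y => y ^ 2 * B y + s * (K / y ^ 2)) (Ici x₀) :=
    fun s x hx => (hd x (hx0.trans_le hx) s).continuousAt.continuousWithinAt
  -- Adding or subtracting `K/x²` makes `f` monotone without changing its limit `1`; this replaces
  -- the integration.
  have hanti : AntitoneOn (fun y => y ^ 2 * B y + 1 * (K / y ^ 2)) (Ici x₀) := by
    refine antitoneOn_of_deriv_nonpos (convex_Ici x₀) (hcont 1) ?_ ?_ <;>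
      rw [interior_Ici] <;> intro x hx
    · exact (hd x (hx0.trans hx) 1).differentiableAt.differentiableWithinAt
    · rw [(hd x (hx0.trans hx) 1).deriv]
      have := (abs_le.1 (hG x (le_of_lt hx))).2
      exact div_nonpos_of_nonpos_of_nonneg (by linarith) (pow_nonneg (hx0.trans hx).le 3)
  have hmono : MonotoneOn (fun y => y ^ 2 * B y + (-1) * (K / y ^ 2)) (Ici x₀) := by
    refine monotoneOn_of_deriv_nonneg (convex_Ici x₀) (hcont (-1)) ?_ ?_ <;>
      rw [interior_Ici] <;> intro x hx
    · exact (hd x (hx0.trans hx) (-1)).differentiableAt.differentiableWithinAt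
    · rw [(hd x (hx0.trans hx) (-1)).deriv]
      have := (abs_le.1 (hG x (le_of_lt hx))).1
      exact div_nonneg (by linarith) (pow_nonneg (hx0.trans hx).le 3)
  refine ⟨K, x₀, hK, hx0, fun x hx => abs_le.2 ⟨?_, ?_⟩⟩
  · have := le_of_tendsto (hlim 1) ((eventually_ge_atTop x).mono
      fun y hy => hanti hx (hx.trans hy) hy)
    simp only at this
    linarith
  · have := ge_of_tendsto (hlim (-1)) ((eventually_ge_atTop x).mono
      fun y hy => hmono hx (hx.trans hy) hy)
    simp only at this
    linarith

end IsBryantProfile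

/-! ### Limits of the barriers as `t → 0` at fixed `σ`. -/

theorem aConst_pos {n : ℕ} (hn : 2 ≤ n) : 0 < aConst n := by
  have : (2 : ℝ) ≤ n := by exact_mod_cast hn
  unfold aConst
  linarith

theorem kappaZero_pos {n : ℕ} (hn : 2 ≤ n) (b : ℝ) : 0 < kappaZero n b :=
  Real.rpow_pos_of_pos (aConst_pos hn) _

theorem sq_kappaZero {n : ℕ} (hn : 2 ≤ n) (b : ℝ) :
    kappaZero n b ^ 2 = (aConst n ^ (1 + b))⁻¹ := by
  unfold kappaZero
  rw [← Real.rpow_natCast, ← Real.rpow_mul (aConst_pos hn).le, ← Real.rpow_neg (aConst_pos hn).le]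
  congr 1
  push_cast
  ring

theorem rhoOf_eq (b σ : ℝ) {t : ℝ} (ht : 0 < t) : rhoOf b σ t = σ * t ^ (b / 2) := by
  unfold rhoOf theta
  rw [Real.sqrt_eq_rpow, mul_div_assoc, ← Real.rpow_sub ht]
  congr 2
  ring

theorem sq_rhoOf (b σ : ℝ) {t : ℝ} (ht : 0 < t) : rhoOf b σ t ^ 2 = σ ^ 2 * t ^ b := by
  rw [rhoOf_eq b σ ht, mul_pow, ← Real.rpow_natCast (t ^ (b / 2)), ← Real.rpow_mul ht.le]
  congr 2
  push_cast
  ring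

theorem tendsto_rpow_nhdsGT_zero {p : ℝ} (hp : 0 < p) :
    Tendsto (fun t : ℝ => t ^ p) (𝓝[>] 0) (𝓝 0) := by
  have h := (Real.continuousAt_rpow_const 0 p (Or.inr hp.le)).tendsto
  rw [Real.zero_rpow hp.ne'] at h
  exact h.mono_left nhdsWithin_le_nhds

theorem tendsto_rhoOf {b : ℝ} (hb : 0 < b) (σ : ℝ) :
    Tendsto (rhoOf b σ) (𝓝[>] 0) (𝓝 0) := by
  have h := (tendsto_rpow_nhdsGT_zero (half_pos hb)).const_mul σ
  rw [mul_zero] at h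
  exact h.congr' (eventually_mem_nhdsWithin.mono fun t ht => (rhoOf_eq b σ ht).symm)

theorem thetaThetaT_eq (b : ℝ) {t : ℝ} (ht : 0 < t) :
    thetaThetaT b t = (b + 1) / 2 * t ^ b := by
  have h : HasDerivAt (theta b) ((b + 1) / 2 * t ^ ((b + 1) / 2 - 1)) t :=
    Real.hasDerivAt_rpow_const (Or.inl ht.ne')
  unfold thetaThetaT
  rw [h.deriv, theta, mul_left_comm, ← Real.rpow_add ht]
  congr 2
  ring

theorem tendsto_thetaThetaT {b : ℝ} (hb : 0 < b) :
    Tendsto (thetaThetaT b) (𝓝[>] 0) (𝓝 0) := by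
  have h := (tendsto_rpow_nhdsGT_zero hb).const_mul ((b + 1) / 2)
  rw [mul_zero] at h
  exact h.congr' (eventually_mem_nhdsWithin.mono fun t ht => (thetaThetaT_eq b ht).symm)

theorem tendsto_vInPlus {b : ℝ} (hb : 0 < b) (B C : ℝ → ℝ) (ε κ σ : ℝ) :
    Tendsto (vInPlus B C b ε κ σ) (𝓝[>] 0) (𝓝 (B (κ * σ))) := by
  have h := ((tendsto_thetaThetaT hb).const_mul ((1 - ε) * (C (κ * σ) / κ ^ 2))).const_add
    (B (κ * σ))
  rw [mul_zero, add_zero] at h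
  exact h

theorem tendsto_vInMinus {b : ℝ} (hb : 0 < b) (B C : ℝ → ℝ) (ε κ σ : ℝ) :
    Tendsto (vInMinus B C b ε κ σ) (𝓝[>] 0) (𝓝 (B (κ * σ))) := by
  have h := ((tendsto_thetaThetaT hb).const_mul ((1 + ε) * (C (κ * σ) / κ ^ 2))).const_add
    (B (κ * σ))
  rw [mul_zero, add_zero] at h
  exact h

theorem vParaMinus_eq_vParaPlus (n : ℕ) (b γ D ρ τ : ℝ) :
    vParaMinus n b γ D ρ τ = vParaPlus n b (-γ) (-D) ρ τ := by
  unfold vParaMinus vParaPlus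
  ring

/-- Since `ρ² = σ² t^b` and `e^(bτ) = t^b`, the exponentials cancel against the powers of `ρ`. -/
theorem vParaPlus_rhoOf (n : ℕ) (b γ D : ℝ) {σ t : ℝ} (hσ : 0 < σ) (ht : 0 < t) :
    vParaPlus n b γ D (rhoOf b σ t) (Real.log t) =
      (1 + γ) * (rhoOf b σ t ^ 2 + aConst n) ^ (1 + b) / σ ^ 2 + D / σ ^ 4 := by
  have h1 : Real.exp (b * Real.log t) = t ^ b := by rw [Real.rpow_def_of_pos ht, mul_comm]
  have h2 : Real.exp (2 * b * Real.log t) = (t ^ b) ^ 2 := by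
    rw [← h1, ← Real.exp_nat_mul]
    congr 1
    push_cast
    ring
  have h4 : rhoOf b σ t ^ 4 = (σ ^ 2 * t ^ b) ^ 2 := by rw [← sq_rhoOf b σ ht]; ring
  have h5 : 0 < t ^ b := Real.rpow_pos_of_pos ht b
  unfold vParaPlus paraProfile
  rw [h1, h2, h4]
  generalize (rhoOf b σ t ^ 2 + aConst n) ^ (1 + b) = P
  rw [sq_rhoOf b σ ht]
  field_simp

theorem tendsto_vParaPlus {n : ℕ} (hn : 2 ≤ n) {b : ℝ} (hb : 0 < b) (γ D : ℝ) {σ : ℝ}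
    (hσ : 0 < σ) :
    Tendsto (fun t => vParaPlus n b γ D (rhoOf b σ t) (Real.log t)) (𝓝[>] 0)
      (𝓝 ((1 + γ) * aConst n ^ (1 + b) / σ ^ 2 + D / σ ^ 4)) := by
  have h0 : Tendsto (fun t => rhoOf b σ t ^ 2 + aConst n) (𝓝[>] 0) (𝓝 (aConst n)) := by
    simpa using ((tendsto_rhoOf hb σ).pow 2).add_const (aConst n)
  have h1 := h0.rpow_const (p := 1 + b) (Or.inl (aConst_pos hn).ne')
  have h2 := ((h1.const_mul (1 + γ)).div_const (σ ^ 2)).add_const (D / σ ^ 4)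
  exact h2.congr' (eventually_mem_nhdsWithin.mono fun t ht =>
    (vParaPlus_rhoOf n b γ D hσ ht).symm)

theorem tendsto_vParaMinus {n : ℕ} (hn : 2 ≤ n) {b : ℝ} (hb : 0 < b) (γ D : ℝ) {σ : ℝ}
    (hσ : 0 < σ) :
    Tendsto (fun t => vParaMinus n b γ D (rhoOf b σ t) (Real.log t)) (𝓝[>] 0)
      (𝓝 ((1 - γ) * aConst n ^ (1 + b) / σ ^ 2 - D / σ ^ 4)) := by
  have h := tendsto_vParaPlus hn hb (-γ) (-D) hσ
  simp only [← vParaMinus_eq_vParaPlus] at h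
  convert h using 2
  ring

/-- A scaling parameter with prescribed `κ⁻² = μ`, together with the resulting bounds on the
rescaled Bryant profile. -/
theorem IsBryantProfile.exists_scale {n : ℕ} (hn : 2 ≤ n) (b : ℝ) {B : ℝ → ℝ} {K x₀ μ σ : ℝ}
    (hσ : 0 < σ) (hK : 0 ≤ K)
    (hB : ∀ x, x₀ ≤ x → |x ^ 2 * B x - 1| ≤ K / x ^ 2)
    (hμ : aConst n ^ (1 + b) / 4 ≤ μ) (hμ' : μ ≤ 4 * aConst n ^ (1 + b))
    (hx₀ : 2 * x₀ / kappaZero n b ≤ σ) :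
    ∃ κ ∈ Icc (kappaZero n b / 2) (2 * kappaZero n b), ∀ s, σ ≤ s →
      |B (κ * s) - μ / s ^ 2| ≤ 16 * K * (aConst n ^ (1 + b)) ^ 2 / s ^ 4 := by
  have hk := kappaZero_pos hn b
  have hk2 := sq_kappaZero hn b
  set α := aConst n ^ (1 + b) with hα
  have hα0 : 0 < α := Real.rpow_pos_of_pos (aConst_pos hn) _
  have hμ0 : 0 < μ := by linarith
  have hsq : (√μ)⁻¹ ^ 2 = μ⁻¹ := by rw [inv_pow, Real.sq_sqrt hμ0.le]
  have hκ0 : 0 < (√μ)⁻¹ := inv_pos.2 (Real.sqrt_pos.2 hμ0)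
  -- As `κ₀⁻² = α`, the range for `κ` is exactly `α/4 ≤ μ ≤ 4α`.
  have hmem : (√μ)⁻¹ ∈ Icc (kappaZero n b / 2) (2 * kappaZero n b) := by
    constructor
    · refine (pow_le_pow_iff_left₀ (by positivity) hκ0.le two_ne_zero).1 ?_
      rw [hsq, div_pow, hk2, ← one_div, ← one_div, div_div, div_le_div_iff₀ (by positivity) hμ0]
      linarith
    · refine (pow_le_pow_iff_left₀ hκ0.le (by positivity) two_ne_zero).1 ?_
      rw [hsq, mul_pow, hk2, ← one_div, ← div_eq_mul_inv, div_le_div_iff₀ hμ0 hα0]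
      linarith
  refine ⟨(√μ)⁻¹, hmem, fun s hs => ?_⟩
  have hs0 : 0 < s := hσ.trans_le hs
  have hx : x₀ ≤ (√μ)⁻¹ * s := by
    rw [div_le_iff₀ hk] at hx₀
    nlinarith [mul_le_mul hmem.1 hs hσ.le hκ0.le]
  have h := hB _ hx
  rw [mul_pow, hsq] at h
  have h1 : B ((√μ)⁻¹ * s) - μ / s ^ 2 =
      μ / s ^ 2 * (μ⁻¹ * s ^ 2 * B ((√μ)⁻¹ * s) - 1) := by
    field_simp
  rw [h1, abs_mul, abs_of_pos (by positivity)]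
  calc _ ≤ μ / s ^ 2 * (K / (μ⁻¹ * s ^ 2)) := by gcongr
    _ = K * μ ^ 2 / s ^ 4 := by field_simp
    _ ≤ K * (4 * α) ^ 2 / s ^ 4 := by gcongr
    _ = _ := by ring

end RicciNeckpinch

/-! ### Choice of constants and gluing. -/

theorem mainTheorem6 (n : ℕ) (hn : 2 ≤ n) (b : ℝ) (hb0 : 0 < b) (hb1 : b < 1)
    (B C : ℝ → ℝ) (hB : RicciNeckpinch.IsBryantProfile n B)
    (hC : RicciNeckpinch.IsInnerCorrection n B C)
    (ρs τs γp γm : ℝ) (hρ : 0 < ρs)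
    (hγp : 0 < γp) (hγp' : γp < 3) (hγm : 0 < γm) (hγm' : γm < 3 / 4) :
    ∃ D₀ : ℝ, 0 < D₀ ∧ ∀ D : ℝ, D₀ ≤ D →
    ∃ σ₀ : ℝ, 0 < σ₀ ∧ ∀ σs : ℝ, σ₀ ≤ σs →
    ∃ κp ∈ Set.Icc (RicciNeckpinch.kappaZero n b / 2) (2 * RicciNeckpinch.kappaZero n b),
    ∃ κm ∈ Set.Icc (RicciNeckpinch.kappaZero n b / 2) (2 * RicciNeckpinch.kappaZero n b),
    ∀ ε : ℝ, 0 < ε →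
    ∃ ts : ℝ, 0 < ts ∧ ts ≤ Real.exp τs ∧
      ∀ t : ℝ, 0 < t → t < ts →
        RicciNeckpinch.rhoOf b (3 * σs) t < ρs ∧
        RicciNeckpinch.vParaMinus n b γm D (RicciNeckpinch.rhoOf b σs t) (Real.log t)
          < RicciNeckpinch.vInMinus B C b ε κm σs t ∧
        RicciNeckpinch.vInMinus B C b ε κm (3 * σs) t
          < RicciNeckpinch.vParaMinus n b γm D (RicciNeckpinch.rhoOf b (3 * σs) t) (Real.log t) ∧
        RicciNeckpinch.vInPlus B C b ε κp σs t
          < RicciNeckpinch.vParaPlus n b γp D (RicciNeckpinch.rhoOf b σs t) (Real.log t) ∧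
        RicciNeckpinch.vParaPlus n b γp D (RicciNeckpinch.rhoOf b (3 * σs) t) (Real.log t)
          < RicciNeckpinch.vInPlus B C b ε κp (3 * σs) t := by
  open RicciNeckpinch in
  obtain ⟨K, x₀, hK, hx0, hBK⟩ := hB.exists_abs_scaled_sub_one_le hn
  have hα0 : 0 < aConst n ^ (1 + b) := Real.rpow_pos_of_pos (aConst_pos hn) _
  have hk := kappaZero_pos hn b
  set α := aConst n ^ (1 + b) with hα
  -- The gap `D/2` at `σs` must beat the error `16Kα²`; at `3σs` the gap `7D/162` against `16Kα²/81`
  -- asks for less.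
  refine ⟨32 * K * α ^ 2 + 1, by positivity, fun D hD => ?_⟩
  have hD0 : 0 < D := lt_of_lt_of_le (by positivity) hD
  have hp : 0 < (3 - γp) * α := mul_pos (by linarith) hα0
  have hm : 0 < (3 / 4 - γm) * α := mul_pos (by linarith) hα0
  -- The second term puts `κσ` in the range of the expansion; the last two keep `μ` in `[α/4, 4α]`,
  -- which is where `γp < 3` and `γm < 3/4` enter.
  refine ⟨1 + 2 * x₀ / kappaZero n b + D / ((3 - γp) * α) + D / ((3 / 4 - γm) * α),
    by positivity, fun σ hσ => ?_⟩
  have e1 : 0 < 2 * x₀ / kappaZero n b := by positivity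
  have e2 : 0 < D / ((3 - γp) * α) := by positivity
  have e3 : 0 < D / ((3 / 4 - γm) * α) := by positivity
  have hσ1 : 1 ≤ σ := by linarith
  have hσ0 : 0 < σ := by linarith
  have hσσ : σ ≤ 2 * σ ^ 2 := by nlinarith
  have hDp : D / (2 * σ ^ 2) ≤ (3 - γp) * α := by
    rw [div_le_comm₀ (by positivity) hp]
    linarith
  have hDm : D / (2 * σ ^ 2) ≤ (3 / 4 - γm) * α := by
    rw [div_le_comm₀ (by positivity) hm]
    linarith
  have hDσ : 0 < D / (2 * σ ^ 2) := by positivity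
  have hgp : 0 < γp * α := mul_pos hγp hα0
  have hgm : 0 < γm * α := mul_pos hγm hα0
  -- Half of the parabolic correction `±D/σ²` at the inner gluing point goes into `κ⁻²`.
  obtain ⟨κp, hκp, hBp⟩ := IsBryantProfile.exists_scale (σ := σ) hn b hσ0 hK.le hBK
    (μ := (1 + γp) * α + D / (2 * σ ^ 2)) (by linarith) (by linarith) (by linarith)
  obtain ⟨κm, hκm, hBm⟩ := IsBryantProfile.exists_scale (σ := σ) hn b hσ0 hK.le hBK
    (μ := (1 - γm) * α - D / (2 * σ ^ 2)) (by linarith) (by linarith) (by linarith)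
  refine ⟨κp, hκp, κm, hκm, fun ε _ => ?_⟩
  have h3σ : 0 < 3 * σ := by linarith
  have hσ4 : 0 < σ ^ 4 := by positivity
  have p1 := (abs_le.1 (hBp σ le_rfl)).2
  have p2 := (abs_le.1 (hBp (3 * σ) (by linarith))).1
  have m1 := (abs_le.1 (hBm σ le_rfl)).1
  have m2 := (abs_le.1 (hBm (3 * σ) (by linarith))).2
  set E := K * α ^ 2 with hE
  have q1 : 32 * E / σ ^ 4 < D / σ ^ 4 := by
    gcongr
    linarith
  have r1 : ∀ c : ℝ, (c + D / (2 * σ ^ 2)) / σ ^ 2 = c / σ ^ 2 + D / σ ^ 4 / 2 := by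
    intro c; field_simp
  have r2 : ∀ c : ℝ, (c - D / (2 * σ ^ 2)) / σ ^ 2 = c / σ ^ 2 - D / σ ^ 4 / 2 := by
    intro c; field_simp
  have r3 : ∀ c : ℝ, c / (3 * σ) ^ 2 = c / σ ^ 2 / 9 := by intro c; field_simp; norm_num
  have r4 : ∀ c : ℝ, c / (3 * σ) ^ 4 = c / σ ^ 4 / 81 := by intro c; field_simp; norm_num
  have r5 : ∀ y : ℝ, 16 * K * α ^ 2 / y = 16 * E / y := by intro y; rw [hE]; ring
  have r6 : 32 * E / σ ^ 4 = 32 * (E / σ ^ 4) := by ring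
  have r7 : 16 * E / σ ^ 4 = 16 * (E / σ ^ 4) := by ring
  have r8 : 0 < E / σ ^ 4 := by positivity
  simp only [← hα, r3, r4, r5, r1, r2, r7] at p1 p2 m1 m2
  rw [r6] at q1
  have key : ∀ᶠ t in 𝓝[>] (0 : ℝ), t ∈ Set.Iio (Real.exp τs) ∧
        rhoOf b (3 * σ) t < ρs ∧
        vParaMinus n b γm D (rhoOf b σ t) (Real.log t) < vInMinus B C b ε κm σ t ∧
        vInMinus B C b ε κm (3 * σ) t
          < vParaMinus n b γm D (rhoOf b (3 * σ) t) (Real.log t) ∧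
        vInPlus B C b ε κp σ t < vParaPlus n b γp D (rhoOf b σ t) (Real.log t) ∧
        vParaPlus n b γp D (rhoOf b (3 * σ) t) (Real.log t) < vInPlus B C b ε κp (3 * σ) t := by
    refine Filter.Eventually.and (nhdsWithin_le_nhds (Iio_mem_nhds (Real.exp_pos τs))) <|
      ((tendsto_rhoOf hb0 _).eventually_lt_const hρ).and <|
      ((tendsto_vParaMinus hn hb0 γm D hσ0).eventually_lt
        (tendsto_vInMinus hb0 B C ε κm σ) ?_).and <|
      ((tendsto_vInMinus hb0 B C ε κm (3 * σ)).eventually_lt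
        (tendsto_vParaMinus hn hb0 γm D h3σ) ?_).and <|
      ((tendsto_vInPlus hb0 B C ε κp σ).eventually_lt
        (tendsto_vParaPlus hn hb0 γp D hσ0) ?_).and <|
      ((tendsto_vParaPlus hn hb0 γp D h3σ).eventually_lt
        (tendsto_vInPlus hb0 B C ε κp (3 * σ)) ?_)
    all_goals
      simp only [r3, r4, ← hα]
      linarith
  obtain ⟨u, hu, hsub⟩ := mem_nhdsGT_iff_exists_Ioo_subset.1 key
  refine ⟨min u (Real.exp τs), lt_min hu (Real.exp_pos _), min_le_right _ _, fun t ht htu => ?_⟩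
  exact (hsub ⟨ht, htu.trans_le (min_le_left _ _)⟩).2
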